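/- Let $R_0$ be a commutative Noetherian domain, let $S=R_0[U_1,\dots,U_s]$ be graded by giving $U_i$ a positive degree $d_i$ (and the elements of $R_0$ degree $0$), let $I\subseteq S$ be a homogeneous ideal (equivalently, an ideal generated by finitely many homogeneous elements $f_1,\dots,f_r$), and put $R=S/I$. Let $R_+$ be the ideal of $R$ generated by the homogeneous elements of positive degree, that is, by the images of $U_1,\dots,U_s$, and let $H^s_{R_+}(R)_{n}$ denote the component of degree $n\in\mathbb Z$ of the $s$-th local cohomology module of $R$ with support in $R_+$, with its natural grading (the one given by the Čech complex on the images of $U_1,\dots,U_s$). The content $\mathfrak c(I)\subseteq R_0$ is the ideal generated by all the coefficients of all the elements of $I$. Then: (1) for every $d$ in the additive semigroup (with $0$) $\{\sum_{i=1}^s\lambda_i d_i : \lambda_i\in\mathbb Z,\ \lambda_i\ge 0\}$ generated by $d_1,\dots,d_s$, every associated prime of the $R_0$-module $H^s_{R_+}(R)_{-d}$ contains $\mathfrak c(I)$; (2) for every $d$ of the form $d=\sum_{i=1}^s\lambda_i d_i$ with integers $\lambda_i\ge 1$ for all $i$, one has $H^s_{R_+}(R)_{-d}=0$ if and only if $\mathfrak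 c(I)=R_0$. -/

import Mathlib

open MvPolynomial

attribute [local instance] MvPolynomial.weightedGradedAlgebra

noncomputable section

namespace GradedCech

/-! ### Graded local cohomology of a graded algebra, through the Čech complex

`A` is a commutative `R₀`-algebra, `𝒜 n` is its component of degree `n ∈ ℤ`, and
`u 0, …, u (s-1)` are homogeneous elements of `A`, `u i` of degree `e i`.  The local cohomology
of `A` with support in the ideal `(u 0, …, u (s-1))` is the cohomology of the Čech complex
`0 → A → ⨁ᵢ A_{uᵢ} → ⨁_{i<j} A_{uᵢuⱼ} → ⋯ → A_{u₀⋯uₛ₋₁} → 0`, a complex of graded modules and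
homogeneous maps of degree `0`; its component of degree `n` is the cohomology of the subcomplex
of elements of degree `n`. -/

section

variable {A : Type*} [CommRing A] {s : ℕ}

/-- The localization of `A` at the product of the `u i`, `i ∈ σ`. -/
abbrev Loc (u : Fin s → A) (σ : Finset (Fin s)) : Type _ :=
  Localization.Away (∏ i ∈ σ, u i)

theorem isUnit_algebraMap_of_subset (u : Fin s → A) {σ τ : Finset (Fin s)} (h : σ ⊆ τ)
    (y : Submonoid.powers (∏ i ∈ σ, u i)) :
    IsUnit (Algebra.ofId A (Loc u τ) (y : A)) := by
  obtain ⟨_, k, rfl⟩ := y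
  have h1 : IsUnit (algebraMap A (Loc u τ) (∏ i ∈ τ, u i)) :=
    IsLocalization.Away.algebraMap_isUnit _
  have h2 : IsUnit (algebraMap A (Loc u τ) (∏ i ∈ σ, u i)) :=
    isUnit_of_dvd_unit (map_dvd _ (Finset.prod_dvd_prod_of_subset σ τ u h)) h1
  simpa [Algebra.ofId_apply] using h2.pow k

/-- The canonical map of localizations for `σ ⊆ τ`. -/
def res (u : Fin s → A) {σ τ : Finset (Fin s)} (h : σ ⊆ τ) : Loc u σ →ₐ[A] Loc u τ :=
  IsLocalization.liftAlgHom (M := Submonoid.powers (∏ i ∈ σ, u i))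
    (f := Algebra.ofId A (Loc u τ)) (isUnit_algebraMap_of_subset u h)

/-- Čech cochains of degree `p`: a family of elements `c σ ∈ A_{∏ i ∈ σ, u i}`, one for each
`p`-element set `σ` of indices. -/
abbrev Cochain (u : Fin s → A) (p : ℕ) : Type _ :=
  ∀ σ : {σ : Finset (Fin s) // σ.card = p}, Loc u σ.1

/-- The face of a `(p+1)`-element set that omits one of its elements. -/
def face {p : ℕ} (τ : {τ : Finset (Fin s) // τ.card = p + 1}) (j : {j // j ∈ τ.1}) :
    {σ : Finset (Fin s) // σ.card = p} :=
  ⟨τ.1.erase j.1, by rw [Finset.card_erase_of_mem j.2, τ.2]; rfl⟩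

theorem face_subset {p : ℕ} (τ : {τ : Finset (Fin s) // τ.card = p + 1}) (j : {j // j ∈ τ.1}) :
    (face τ j).1 ⊆ τ.1 :=
  Finset.erase_subset _ _

/-- The Čech differential: `(δ c) τ = ∑_{j ∈ τ} (-1)^{#{i ∈ τ : i < j}} c (τ \ {j})`. -/
def delta (u : Fin s → A) (p : ℕ) : Cochain u p →ₗ[A] Cochain u (p + 1) :=
  LinearMap.pi fun τ => ∑ j : {j // j ∈ τ.1},
    ((-1 : ℤ) ^ (τ.1.filter (· < j.1)).card) •
      ((res u (face_subset τ j)).toLinearMap ∘ₗ LinearMap.proj (face τ j))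

theorem res_res (u : Fin s → A) {σ τ ρ : Finset (Fin s)} (h : σ ⊆ τ) (h' : τ ⊆ ρ) (x : Loc u σ) :
    res u h' (res u h x) = res u (h.trans h') x := by
  have : (res u h').comp (res u h) = res u (h.trans h') :=
    IsLocalization.algHom_ext (Submonoid.powers (∏ i ∈ σ, u i)) (by ext)
  rw [← this]; rfl

theorem delta_delta (u : Fin s → A) (p : ℕ) (c : Cochain u p) :
    delta u (p + 1) (delta u p c) = 0 := by
  funext τ
  simp only [delta, LinearMap.pi_apply, LinearMap.sum_apply, LinearMap.smul_apply,
    LinearMap.comp_apply, LinearMap.proj_apply, AlgHom.toLinearMap_apply, map_sum, map_zsmul,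
    Finset.smul_sum, res_res, smul_smul, Pi.zero_apply]
  rw [Finset.sum_sigma']
  have hmem : ∀ a : (Σ j : {j // j ∈ τ.1}, {k // k ∈ (face τ j).1}),
      a.2.1 ≠ a.1.1 ∧ a.2.1 ∈ τ.1 := fun a => Finset.mem_erase.mp a.2.2
  refine Finset.sum_involution
    (fun a _ => ⟨⟨a.2.1, (hmem a).2⟩, ⟨a.1.1, Finset.mem_erase.mpr ⟨(hmem a).1.symm, a.1.2⟩⟩⟩)
    ?_ ?_ (fun _ _ => Finset.mem_univ _) (fun _ _ => rfl)
  · rintro ⟨⟨j, hj⟩, ⟨k, hk⟩⟩ -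
    obtain ⟨hkj, hkτ⟩ := Finset.mem_erase.mp hk
    have key : ∀ (σ σ' : {σ : Finset (Fin s) // σ.card = p}) (h : σ.1 ⊆ τ.1) (h' : σ'.1 ⊆ τ.1),
        σ = σ' → res u h (c σ) = res u h' (c σ') := by
      rintro σ _ h h' rfl; rfl
    rw [key (face (face τ ⟨j, hj⟩) ⟨k, hk⟩)
      (face (face τ ⟨k, hkτ⟩) ⟨j, Finset.mem_erase.mpr ⟨hkj.symm, hj⟩⟩) _
      ((face_subset _ _).trans (face_subset _ _))
      (Subtype.ext (Finset.erase_right_comm))]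
    rw [← add_smul]
    have hs : ∀ a b : Fin s, a ∈ τ.1 → b ∈ τ.1 → a < b →
        (-1 : ℤ) ^ (τ.1.filter (· < a)).card * (-1) ^ ((τ.1.erase a).filter (· < b)).card
        + (-1 : ℤ) ^ (τ.1.filter (· < b)).card * (-1) ^ ((τ.1.erase b).filter (· < a)).card = 0 := by
      intro a b ha hb hab
      have e1 : (τ.1.erase b).filter (· < a) = τ.1.filter (· < a) := by
        ext x; simp only [Finset.mem_filter, Finset.mem_erase]
        constructor
        · tauto
        · rintro ⟨h1, h2⟩; exact ⟨⟨(h2.trans hab).ne, h1⟩, h2⟩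
      have e2 : (τ.1.erase a).filter (· < b) = (τ.1.filter (· < b)).erase a := Finset.filter_erase _ _ _
      have ha' : a ∈ τ.1.filter (· < b) := by simp [ha, hab]
      rw [e1, e2, ← Finset.card_erase_add_one ha']
      ring
    rcases lt_or_gt_of_ne hkj with h | h
    · have := hs k j hkτ hj h
      simp only [face]
      exact (congrArg (· • _) ((add_comm _ _).trans this)).trans (zero_smul _ _)
    · have := hs j k hj hkτ h
      simp only [face]
      exact (congrArg (· • _) this).trans (zero_smul _ _)
  · rintro ⟨⟨j, hj⟩, ⟨k, hk⟩⟩ - _ heq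
    have h := congrArg (fun a => a.1.1) heq
    exact (Finset.mem_erase.mp hk).1 h

end

section

variable (R₀ : Type*) [CommRing R₀] {A : Type*} [CommRing A] [Algebra R₀ A] {s : ℕ}
  (𝒜 : ℤ → Submodule R₀ A) (u : Fin s → A) (e : Fin s → ℤ)

/-- The component of degree `n` of the localization of `A` at `∏ i ∈ σ, u i`: it consists of the
fractions `a / (∏ i ∈ σ, u i) ^ k` with `a` homogeneous of degree `n + k * ∑ i ∈ σ, e i`. -/
def locComponent (σ : Finset (Fin s)) (n : ℤ) : Submodule R₀ (Loc u σ) :=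
  Submodule.span R₀ {x | ∃ k : ℕ, ∃ a ∈ 𝒜 (n + k * ∑ i ∈ σ, e i),
    x = Localization.mk a (⟨(∏ i ∈ σ, u i) ^ k, k, rfl⟩ : Submonoid.powers (∏ i ∈ σ, u i))}

/-- The Čech cochains that are homogeneous of degree `n`. -/
def strand (p : ℕ) (n : ℤ) : Submodule R₀ (Cochain u p) :=
  Submodule.pi Set.univ fun σ => locComponent R₀ 𝒜 u e σ.1 n

/-- The `p`-cocycles that are homogeneous of degree `n`. -/
def cocycles (p : ℕ) (n : ℤ) : Submodule R₀ (Cochain u p) :=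
  strand R₀ 𝒜 u e p n ⊓ (LinearMap.ker (delta u p)).restrictScalars R₀

/-- The `p`-coboundaries of the cochains that are homogeneous of degree `n`. -/
def coboundaries (p : ℕ) (n : ℤ) : Submodule R₀ (Cochain u p) :=
  match p with
  | 0 => ⊥
  | q + 1 => (strand R₀ 𝒜 u e q n).map ((delta u q).restrictScalars R₀)

/-- The component of degree `n` of the `p`-th local cohomology module of `A` with support in the
ideal generated by the homogeneous elements `u i`, as an `R₀`-module. -/
abbrev LocalCohomology (p : ℕ) (n : ℤ) : Type _ :=
  ↥(cocycles R₀ 𝒜 u e p n) ⧸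
    (coboundaries R₀ 𝒜 u e p n).submoduleOf (cocycles R₀ 𝒜 u e p n)

end

end GradedCech

/-! ### Quotients of weighted polynomial rings -/

section

variable {R₀ : Type*} [CommRing R₀] {s : ℕ}

/-- The component of degree `n ∈ ℤ` of `R = R₀[U₁, …, Uₛ] / I`, where `Uᵢ` has degree `deg i`:
the classes of the weighted homogeneous polynomials of degree `n` (none but `0` if `n < 0`). -/
def quotComponent (deg : Fin s → ℕ) (I : Ideal (MvPolynomial (Fin s) R₀)) (n : ℤ) :
    Submodule R₀ (MvPolynomial (Fin s) R₀ ⧸ I) :=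
  (weightedHomogeneousSubmodule R₀ (fun i => (deg i : ℤ)) n).map
    (Ideal.Quotient.mkₐ R₀ I).toLinearMap

/-- The component of degree `n` of `H^p_{R₊}(R)`, where `R = R₀[U₁, …, Uₛ] / I` and `R₊` is the
ideal generated by the homogeneous elements of positive degree, that is, by the images of the
variables (see `irrelevant_eq_span`). -/
abbrev LocalCohomologyQuot (deg : Fin s → ℕ) (I : Ideal (MvPolynomial (Fin s) R₀))
    (p : ℕ) (n : ℤ) : Type _ :=
  GradedCech.LocalCohomology R₀ (quotComponent deg I)
    (fun i => Ideal.Quotient.mk I (X i)) (fun i => (deg i : ℤ)) p n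

/-- The content of an ideal `J` of a polynomial ring: the ideal of `R₀` generated by the
coefficients of all the elements of `J`. -/
def contentIdeal (J : Ideal (MvPolynomial (Fin s) R₀)) : Ideal R₀ :=
  Ideal.span {a | ∃ f ∈ J, ∃ m, f.coeff m = a}

theorem irrelevant_eq_span (deg : Fin s → ℕ) (hdeg : ∀ i, 0 < deg i)
    (I : Ideal (MvPolynomial (Fin s) R₀)) :
    Ideal.span (⋃ n ∈ Set.Ioi (0 : ℤ), (quotComponent deg I n : Set (MvPolynomial (Fin s) R₀ ⧸ I)))
      = Ideal.span (Set.range fun i : Fin s => Ideal.Quotient.mk I (X i)) := by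
  apply le_antisymm
  · rw [Ideal.span_le]
    intro x hx
    simp only [Set.mem_iUnion, Set.mem_Ioi] at hx
    obtain ⟨n, hn, p, hp, rfl⟩ := hx
    have hmem : p ∈ Ideal.span (X '' (Set.univ : Set (Fin s)) :
        Set (MvPolynomial (Fin s) R₀)) := by
      rw [mem_ideal_span_X_image]
      intro m hm
      by_contra hcon
      push Not at hcon
      have hm0 : m = 0 := by
        ext i
        simpa using hcon i (Set.mem_univ i)
      have h1 := hp (mem_support_iff.mp hm)
      subst hm0
      simp at h1
      omega
    have h2 := Ideal.mem_map_of_mem (Ideal.Quotient.mk I) hmem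
    rw [Ideal.map_span, Set.image_univ, ← Set.range_comp] at h2
    exact h2
  · rw [Ideal.span_le]
    rintro _ ⟨i, rfl⟩
    apply Ideal.subset_span
    simp only [Set.mem_iUnion, Set.mem_Ioi]
    refine ⟨(deg i : ℤ), by exact_mod_cast hdeg i, X i, ?_, rfl⟩
    exact isWeightedHomogeneous_X R₀ _ i

/-- The degrees `-d` in which the module of inverse polynomials `R₀[U₁⁻, …, Uₛ⁻]` lives: the
integers `∑ λᵢ dᵢ` with all `λᵢ ≥ 1`. -/
def inverseDegrees (deg : Fin s → ℕ) : Set ℕ :=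
  {d | ∃ l : Fin s → ℕ, (∀ i, 1 ≤ l i) ∧ d = ∑ i, l i * deg i}

end

end

/-! In the top degree of the Čech complex every cochain is a cocycle. The cochains of degree `n` are
spanned over `R₀` by Laurent monomials `u^b` of degree `n`, and `u^b` is a coboundary once some `b i
≥ 0`. So the cohomology is generated by the classes of the finitely many inverse monomials (all `b i
< 0`) of degree `n`.

Let `p` be a prime not containing the content. Homogeneity of `I` gives a homogeneous `f ∈ I` with a
coefficient outside `p`; let `m₀` be the lexicographically least exponent of such a coefficient. The
relations `u^(b - m₀) f = 0`, one for each inverse monomial `u^b`, form a square system whose matrix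
is upper triangular modulo `p`, with the coefficient of `m₀` on the diagonal. Its determinant lies
outside `p` and, by the adjugate identity, kills the cohomology (`exists_notMem_smul_eq_zero`). This
gives (1), and the vanishing in (2) by taking `p` maximal.

Conversely, every coefficient of every element of `I` dies in `K = R₀ / c(I)`, so `R` maps to the
Laurent polynomials over `K`. If `K ≠ 0`, the coefficient at an inverse exponent kills all
coboundaries but is `1` on the corresponding monomial (`not_subsingleton_localCohomologyQuot`). -/

noncomputable section

namespace GradedCech

/-! ### Laurent monomials and top cochains -/

section

variable {A : Type*} [CommRing A] {s : ℕ} (u : Fin s → A)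

theorem isUnit_algebraMap_of_mem {σ : Finset (Fin s)} {i : Fin s} (h : i ∈ σ) :
    IsUnit (algebraMap A (Loc u σ) (u i)) :=
  isUnit_of_dvd_unit (map_dvd _ (Finset.dvd_prod_of_mem u h))
    (IsLocalization.Away.algebraMap_isUnit (∏ i ∈ σ, u i))

/-- The unit of the localization at the product of all `u i` given by `u i`. -/
def unitOf (i : Fin s) : (Loc u Finset.univ)ˣ :=
  (isUnit_algebraMap_of_mem u (Finset.mem_univ i)).unit

/-- The Laurent monomial `∏ u i ^ b i` with exponents `b i ∈ ℤ`. -/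
def laurent (b : Fin s → ℤ) : Loc u Finset.univ :=
  ((∏ i, unitOf u i ^ b i : (Loc u Finset.univ)ˣ) : Loc u Finset.univ)

theorem laurent_add (a b : Fin s → ℤ) : laurent u (a + b) = laurent u a * laurent u b := by
  simp only [laurent, Pi.add_apply, zpow_add, Finset.prod_mul_distrib, Units.val_mul]

theorem laurent_natCast (m : Fin s → ℕ) :
    laurent u (fun i => (m i : ℤ)) = algebraMap A _ (∏ i, u i ^ m i) := by
  simp [laurent, unitOf, Units.coe_prod, map_prod]

theorem isUnit_laurent (b : Fin s → ℤ) : IsUnit (laurent u b) := Units.isUnit _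

theorem res_algebraMap {σ τ : Finset (Fin s)} (h : σ ⊆ τ) (a : A) :
    res u h (algebraMap A _ a) = algebraMap A _ a := (res u h).commutes a

theorem res_self {σ : Finset (Fin s)} (h : σ ⊆ σ) (x : Loc u σ) : res u h x = x := by
  have : res u h = AlgHom.id A _ :=
    IsLocalization.algHom_ext (Submonoid.powers (∏ i ∈ σ, u i)) (by ext)
  rw [this]; rfl

/-- The top Čech cochain given by an element of the localization at the product of all `u i`. -/
def topCochain : Loc u Finset.univ →ₗ[A] Cochain u s :=
  LinearMap.pi fun σ => (res u (Finset.eq_univ_of_card σ.1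
    (by rw [σ.2, Fintype.card_fin])).ge).toLinearMap

/-- The value of a top Čech cochain at the set of all indices. -/
def topValue : Cochain u s →ₗ[A] Loc u Finset.univ :=
  LinearMap.proj (⟨Finset.univ, Finset.card_fin s⟩ : {σ : Finset (Fin s) // σ.card = s})

theorem topValue_topCochain (x : Loc u Finset.univ) : topValue u (topCochain u x) = x :=
  res_self u subset_rfl x

theorem topCochain_topValue (z : Cochain u s) : topCochain u (topValue u z) = z := by
  funext ⟨σ, hσ⟩
  obtain rfl : σ = Finset.univ := Finset.eq_univ_of_card σ (by rw [hσ, Fintype.card_fin])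
  exact res_self u subset_rfl _

theorem delta_top (z : Cochain u s) : delta u s z = 0 := by
  funext ⟨τ, hτ⟩
  have := Finset.card_le_univ τ
  rw [Fintype.card_fin] at this
  omega

end

/-! ### Top cocycles and coboundaries -/

section

variable (R₀ : Type*) [CommRing R₀] {A : Type*} [CommRing A] [Algebra R₀ A] {s : ℕ}
  (𝒜 : ℤ → Submodule R₀ A) (u : Fin s → A) (e : Fin s → ℤ)

theorem cocycles_top (n : ℤ) : cocycles R₀ 𝒜 u e s n = strand R₀ 𝒜 u e s n := by
  refine le_antisymm inf_le_left fun z hz => ⟨hz, ?_⟩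
  exact delta_top u z

theorem topValue_mem {n : ℤ} {z : Cochain u s} (hz : z ∈ strand R₀ 𝒜 u e s n) :
    topValue u z ∈ locComponent R₀ 𝒜 u e Finset.univ n :=
  hz ⟨Finset.univ, Finset.card_fin s⟩ trivial

theorem topCochain_mem {n : ℤ} {x : Loc u Finset.univ}
    (hx : x ∈ locComponent R₀ 𝒜 u e Finset.univ n) :
    topCochain u x ∈ strand R₀ 𝒜 u e s n := by
  rintro ⟨σ, hσ⟩ -
  obtain rfl : σ = Finset.univ := Finset.eq_univ_of_card σ (by rw [hσ, Fintype.card_fin])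
  rw [← res_self u subset_rfl x] at hx
  exact hx

/-- The top coboundaries contain the image of each localization that omits one index. -/
theorem topCochain_res_mem_coboundaries {n : ℤ} (i : Fin s)
    {x : Loc u (Finset.univ.erase i)} (hx : x ∈ locComponent R₀ 𝒜 u e (Finset.univ.erase i) n) :
    topCochain u (res u (Finset.erase_subset _ _) x) ∈ coboundaries R₀ 𝒜 u e s n := by
  cases s with
  | zero => exact i.elim0
  | succ q =>
    let τ : {τ : Finset (Fin (q + 1)) // τ.card = q + 1} := ⟨Finset.univ, Finset.card_fin _⟩
    let σ := face τ ⟨i, Finset.mem_univ i⟩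
    let ε : ℤ := (-1) ^ (τ.1.filter (· < i)).card
    -- `σ.1` is `Finset.univ.erase i` only after unfolding, so `x` is retyped over the face.
    obtain ⟨y, hy, hyx⟩ : ∃ y : Loc u σ.1, y ∈ locComponent R₀ 𝒜 u e σ.1 n ∧
        res u (face_subset τ _) y = res u (Finset.erase_subset _ _) x := ⟨x, hx, rfl⟩
    rw [← hyx]
    have hε : ε * ε = 1 := by
      simp only [ε, ← mul_pow]; simp
    -- The cochain is supported on the face omitting `i`; `ε` cancels the sign of that face in
    -- `delta`.
    refine ⟨ε • Pi.single σ y, ?_, ?_⟩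
    · refine zsmul_mem ?_ _
      intro ρ _
      by_cases h : ρ = σ
      · subst h
        rw [Pi.single_eq_same]
        exact hy
      · rw [Pi.single_eq_of_ne h]
        exact zero_mem _
    · rw [← topCochain_topValue u ((delta u q).restrictScalars R₀ _)]
      congr 1
      change (delta u q (ε • Pi.single σ y)) τ = _
      rw [map_zsmul]
      simp only [delta, Pi.smul_apply, LinearMap.pi_apply, LinearMap.sum_apply,
        LinearMap.smul_apply, LinearMap.comp_apply, LinearMap.proj_apply,
        AlgHom.toLinearMap_apply]
      rw [Finset.sum_eq_single (⟨i, Finset.mem_univ i⟩ : {j // j ∈ τ.1})]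
      · rw [smul_smul, hε, one_smul]
        change res u _ ((Pi.single σ y : Cochain u q) σ) = _
        rw [Pi.single_eq_same]
      · rintro ⟨j, hj⟩ - hji
        have : face τ ⟨j, hj⟩ ≠ σ := by
          intro h
          have h1 : (Finset.univ.erase j : Finset (Fin (q + 1))) = Finset.univ.erase i :=
            congrArg Subtype.val h
          apply hji
          have h2 : j ∉ (Finset.univ.erase i : Finset (Fin (q + 1))) := by rw [← h1]; simp
          simpa using h2
        rw [Pi.single_eq_of_ne this, map_zero]
        exact zsmul_zero _
      · exact fun h => absurd (Finset.mem_univ _) h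

/-- The value of a top coboundary is a sum of elements of the localizations that omit one index. -/
theorem topValue_mem_of_mem_coboundaries {n : ℤ} {z : Cochain u s}
    (hz : z ∈ coboundaries R₀ 𝒜 u e s n) (N : AddSubgroup (Loc u Finset.univ))
    (hN : ∀ (i : Fin s) (x : Loc u (Finset.univ.erase i)),
      res u (Finset.erase_subset _ _) x ∈ N) :
    topValue u z ∈ N := by
  cases s with
  | zero =>
    have : z = 0 := hz
    rw [this, map_zero]
    exact zero_mem _
  | succ q =>
    obtain ⟨c, -, rfl⟩ := hz
    change (delta u q c) ⟨Finset.univ, Finset.card_fin _⟩ ∈ N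
    simp only [delta, LinearMap.pi_apply, LinearMap.sum_apply, LinearMap.smul_apply,
      LinearMap.comp_apply, LinearMap.proj_apply, AlgHom.toLinearMap_apply]
    exact sum_mem fun j _ => zsmul_mem (hN j.1 _) _

/-- A scalar kills the top local cohomology in degree `n` if it carries the cochains of degree `n`
to coboundaries. -/
theorem smul_localCohomology_eq_zero {n : ℤ} {r : R₀}
    (hr : ∀ x ∈ locComponent R₀ 𝒜 u e Finset.univ n,
      r • topCochain u x ∈ coboundaries R₀ 𝒜 u e s n)
    (y : LocalCohomology R₀ 𝒜 u e s n) : r • y = 0 := by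
  obtain ⟨z, rfl⟩ := Submodule.Quotient.mk_surjective _ y
  rw [← Submodule.Quotient.mk_smul, Submodule.Quotient.mk_eq_zero]
  change r • (z : Cochain u s) ∈ coboundaries R₀ 𝒜 u e s n
  rw [← topCochain_topValue u z]
  exact hr _ (topValue_mem R₀ 𝒜 u e z.2.1)

theorem topCochain_mem_coboundaries_of_subsingleton {n : ℤ}
    (h : Subsingleton (LocalCohomology R₀ 𝒜 u e s n)) {x : Loc u Finset.univ}
    (hx : x ∈ locComponent R₀ 𝒜 u e Finset.univ n) :
    topCochain u x ∈ coboundaries R₀ 𝒜 u e s n := by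
  have hz : topCochain u x ∈ cocycles R₀ 𝒜 u e s n := by
    rw [cocycles_top]
    exact topCochain_mem R₀ 𝒜 u e hx
  have h0 := Subsingleton.elim
    (Submodule.Quotient.mk ⟨_, hz⟩ : LocalCohomology R₀ 𝒜 u e s n) 0
  rw [Submodule.Quotient.mk_eq_zero] at h0
  exact h0

end

end GradedCech

end

/-! ### Square systems of relations -/

theorem Matrix.det_smul_eq_zero_of_sum_smul_eq_zero {R M ι : Type*} [CommRing R] [AddCommGroup M]
    [Module R M] [Fintype ι] [DecidableEq ι] (T : Matrix ι ι R) (w : ι → M)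
    (h : ∀ i, ∑ j, T i j • w j = 0) (k : ι) : T.det • w k = 0 := by
  have h1 : ∑ i, T.adjugate k i • ∑ j, T i j • w j = 0 := by simp [h]
  have h2 : ∑ i, T.adjugate k i • ∑ j, T i j • w j = ∑ j, (T.adjugate * T) k j • w j := by
    simp only [Finset.smul_sum, smul_smul, Matrix.mul_apply, Finset.sum_smul]
    exact Finset.sum_comm
  rw [h2, Matrix.adjugate_mul] at h1
  simpa [Matrix.smul_apply, Matrix.one_apply] using h1

/-- Over the domain `R ⧸ p` the matrix is upper triangular, so its determinant is a product of
nonzero diagonal entries. -/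
theorem Matrix.det_notMem_of_isPrime {R ι : Type*} [CommRing R] [Fintype ι] [LinearOrder ι]
    (T : Matrix ι ι R) (p : Ideal R) [p.IsPrime] (hlt : ∀ i j, j < i → T i j ∈ p)
    (hdiag : ∀ i, T i i ∉ p) : T.det ∉ p := by
  rw [← Ideal.Quotient.eq_zero_iff_mem, RingHom.map_det, Matrix.det_of_isUpperTriangular]
  · rw [Finset.prod_eq_zero_iff]
    rintro ⟨i, -, hi⟩
    exact hdiag i (Ideal.Quotient.eq_zero_iff_mem.mp hi)
  · intro i j hij
    exact Ideal.Quotient.eq_zero_iff_mem.mpr (hlt i j hij)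

/-! ### Laurent monomials over a quotient of a polynomial ring -/

noncomputable section

namespace GradedCech

section

variable {R₀ : Type*} [CommRing R₀] {s : ℕ}

theorem ringHom_eq_sum {B : Type*} [CommRing B] (φ : MvPolynomial (Fin s) R₀ →+* B)
    (f : MvPolynomial (Fin s) R₀) :
    φ f = ∑ m ∈ f.support, φ (C (f.coeff m)) * ∏ i, φ (X i) ^ m i := by
  conv_lhs => rw [← MvPolynomial.eval₂_eta f, MvPolynomial.eval₂_eq', map_sum]
  simp only [map_mul, map_prod, map_pow]

theorem weight_eq_sum (w : Fin s → ℤ) (m : Fin s →₀ ℕ) :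
    Finsupp.weight w m = ∑ i, (m i : ℤ) * w i := by
  rw [Finsupp.weight_apply, Finsupp.sum_fintype _ _ (by simp)]
  simp

variable (deg : Fin s → ℕ) (I : Ideal (MvPolynomial (Fin s) R₀))

local notation "𝒰" => fun i : Fin s => Ideal.Quotient.mk I (X i : MvPolynomial (Fin s) R₀)
local notation "ℰ" => fun i : Fin s => (deg i : ℤ)

theorem algebraMap_mk_eq_sum (f : MvPolynomial (Fin s) R₀) :
    algebraMap _ (Loc 𝒰 Finset.univ) (Ideal.Quotient.mk I f) =
      ∑ m ∈ f.support, f.coeff m • laurent 𝒰 (fun i => (m i : ℤ)) := by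
  have h := ringHom_eq_sum
    ((algebraMap _ (Loc 𝒰 Finset.univ)).comp (Ideal.Quotient.mk I)) f
  simp only [RingHom.comp_apply] at h
  rw [h]
  refine Finset.sum_congr rfl fun m _ => ?_
  rw [laurent_natCast, map_prod, Algebra.smul_def]
  simp only [map_pow]
  rfl

theorem algebraMap_prod_pow (σ : Finset (Fin s)) (k : ℕ) :
    algebraMap _ (Loc 𝒰 Finset.univ) ((∏ i ∈ σ, 𝒰 i) ^ k) =
      laurent 𝒰 (fun i => ((if i ∈ σ then k else 0 : ℕ) : ℤ)) := by
  rw [laurent_natCast]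
  congr 1
  rw [← Finset.prod_pow]
  simp [Finset.prod_ite_mem, apply_ite]

/-- Only the variables in `σ` need inverting to form this monomial. -/
theorem exists_res_eq_laurent (σ : Finset (Fin s)) (b : Fin s → ℤ) (hb : ∀ i ∉ σ, 0 ≤ b i) :
    ∃ x ∈ locComponent R₀ (quotComponent deg I) 𝒰 ℰ σ (∑ i, b i * deg i),
      res 𝒰 (Finset.subset_univ σ) x = laurent 𝒰 b := by
  -- Large enough that multiplying by `(∏ i ∈ σ, u i) ^ k` clears all negative exponents.
  let k : ℕ := ∑ j, (b j).natAbs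
  have hk : ∀ i, -(k : ℤ) ≤ b i := by
    intro i
    have : (b i).natAbs ≤ k := Finset.single_le_sum (f := fun j => (b j).natAbs)
      (fun _ _ => Nat.zero_le _) (Finset.mem_univ i)
    omega
  let m : Fin s → ℕ := fun i => (b i + if i ∈ σ then (k : ℤ) else 0).toNat
  have hm : ∀ i, (m i : ℤ) = b i + if i ∈ σ then (k : ℤ) else 0 := by
    intro i
    refine Int.toNat_of_nonneg ?_
    split_ifs with h
    · linarith [hk i]
    · simpa using hb i h
  let P : MvPolynomial (Fin s) R₀ := ∏ i, X i ^ m i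
  have hP : IsWeightedHomogeneous ℰ P
      (∑ i, b i * deg i + k * ∑ i ∈ σ, (deg i : ℤ)) := by
    have h := IsWeightedHomogeneous.prod (w := ℰ) Finset.univ
      (fun i => (X i : MvPolynomial (Fin s) R₀) ^ m i) (fun i => m i • (deg i : ℤ))
      (fun i _ => (isWeightedHomogeneous_X R₀ ℰ i).pow (m i))
    convert h using 1
    simp [hm, add_mul, Finset.sum_add_distrib, Finset.mul_sum, Finset.sum_ite_mem]
  refine ⟨Localization.mk (Ideal.Quotient.mk I P) ⟨(∏ i ∈ σ, 𝒰 i) ^ k, k, rfl⟩,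
    Submodule.subset_span ⟨k, _, ⟨P, hP, rfl⟩, rfl⟩, ?_⟩
  have h1 : (Localization.mk (Ideal.Quotient.mk I P)
      (⟨(∏ i ∈ σ, 𝒰 i) ^ k, k, rfl⟩ : Submonoid.powers (∏ i ∈ σ, 𝒰 i)) : Loc 𝒰 σ) *
      algebraMap _ (Loc 𝒰 σ) ((∏ i ∈ σ, 𝒰 i) ^ k) = algebraMap _ _ (Ideal.Quotient.mk I P) := by
    rw [Localization.mk_eq_mk']
    exact IsLocalization.mk'_spec _ _ _
  have h2 := congrArg (res 𝒰 (Finset.subset_univ σ)) h1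
  rw [map_mul, res_algebraMap, res_algebraMap, algebraMap_prod_pow] at h2
  refine (isUnit_laurent 𝒰 _).mul_left_injective (h2.trans ?_)
  change _ = laurent 𝒰 b * laurent 𝒰 _
  rw [← laurent_add]
  have h3 : (b + fun i => ((if i ∈ σ then k else 0 : ℕ) : ℤ)) = fun i => (m i : ℤ) := by
    funext i
    simp [hm]
  rw [h3, laurent_natCast]
  simp [P]

theorem laurent_mem_locComponent (b : Fin s → ℤ) :
    laurent 𝒰 b ∈ locComponent R₀ (quotComponent deg I) 𝒰 ℰ Finset.univ (∑ i, b i * deg i) := by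
  obtain ⟨x, hx, hxb⟩ := exists_res_eq_laurent deg I Finset.univ b (by simp)
  rwa [← hxb, res_self]

theorem topCochain_laurent_mem_coboundaries (b : Fin s → ℤ) (i : Fin s) (hb : 0 ≤ b i) :
    topCochain 𝒰 (laurent 𝒰 b) ∈
      coboundaries R₀ (quotComponent deg I) 𝒰 ℰ s (∑ i, b i * deg i) := by
  obtain ⟨x, hx, hxb⟩ := exists_res_eq_laurent deg I (Finset.univ.erase i) b (by simpa using hb)
  rw [← hxb]
  exact topCochain_res_mem_coboundaries R₀ _ _ _ i hx

/-- Expand the numerator into monomials and divide each by the monomial denominator; homogeneity of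
the numerator fixes the degree. -/
theorem locComponent_le_span_laurent (n : ℤ) :
    locComponent R₀ (quotComponent deg I) 𝒰 ℰ Finset.univ n ≤
      Submodule.span R₀ {x | ∃ b : Fin s → ℤ, ∑ i, b i * deg i = n ∧ laurent 𝒰 b = x} := by
  refine Submodule.span_le.mpr ?_
  rintro x ⟨k, _, ⟨P, hP, rfl⟩, rfl⟩
  set x : Loc 𝒰 Finset.univ := Localization.mk _ _ with hx
  have h1 : x * algebraMap _ (Loc 𝒰 Finset.univ) ((∏ i ∈ Finset.univ, 𝒰 i) ^ k) =
      algebraMap _ _ (Ideal.Quotient.mk I P) := by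
    rw [hx, Localization.mk_eq_mk']
    exact IsLocalization.mk'_spec _ _ _
  rw [algebraMap_prod_pow, algebraMap_mk_eq_sum] at h1
  have h2 : x = ∑ m ∈ P.support, P.coeff m • laurent 𝒰 (fun i => (m i : ℤ) - k) := by
    refine (isUnit_laurent 𝒰 _).mul_left_injective (h1.trans ?_)
    simp only [Finset.sum_mul, smul_mul_assoc, ← laurent_add]
    refine Finset.sum_congr rfl fun m _ => ?_
    congr 2
    funext i
    simp
  rw [h2]
  refine sum_mem fun m hm => Submodule.smul_mem _ _ (Submodule.subset_span ⟨_, ?_, rfl⟩)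
  have h3 := hP (mem_support_iff.mp hm)
  rw [weight_eq_sum] at h3
  simp only [sub_mul, Finset.sum_sub_distrib, h3, Finset.mul_sum]
  ring

theorem sum_smul_laurent_eq_zero {f : MvPolynomial (Fin s) R₀} (hf : f ∈ I) (c : Fin s → ℤ) :
    ∑ m ∈ f.support, f.coeff m • laurent 𝒰 (c + fun i => (m i : ℤ)) = 0 := by
  have h := algebraMap_mk_eq_sum I f
  rw [Ideal.Quotient.eq_zero_iff_mem.mpr hf, map_zero] at h
  simp only [laurent_add, ← mul_smul_comm, ← Finset.mul_sum, ← h, mul_zero]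

/-! ### Annihilators from a coefficient outside a prime -/

/-- The exponents of the inverse monomials of degree `n`, in lexicographic order. -/
def InverseExponent (n : ℤ) : Type :=
  {b : Lex (Fin s → ℤ) // (∀ i, ofLex b i < 0) ∧ ∑ i, ofLex b i * deg i = n}

instance (n : ℤ) : LinearOrder (InverseExponent deg n) :=
  inferInstanceAs (LinearOrder (Subtype _))

/-- All terms of the sum are negative and the weights are at least `1`, so `n ≤ b i < 0` for every
`i`. -/
theorem finite_inverseExponent (hdeg : ∀ i, 0 < deg i) (n : ℤ) :
    Finite (InverseExponent deg n) := by
  have : Set.Finite {b : Fin s → ℤ | (∀ i, b i < 0) ∧ ∑ i, b i * deg i = n} := by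
    refine (Set.finite_Icc (fun _ => n) (fun _ => 0)).subset ?_
    rintro b ⟨hb, hn⟩
    refine ⟨fun i => ?_, fun i => (hb i).le⟩
    have hneg : ∀ j, b j * deg j ≤ b j := fun j => by
      have : (1 : ℤ) ≤ deg j := by exact_mod_cast hdeg j
      nlinarith [hb j]
    have h1 : ∑ j, b j * (deg j : ℤ) ≤ b i * deg i := by
      rw [← Finset.add_sum_erase _ _ (Finset.mem_univ i)]
      have : ∑ j ∈ Finset.univ.erase i, b j * (deg j : ℤ) ≤ 0 :=
        Finset.sum_nonpos fun j _ => (hneg j).trans (hb j).le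
      linarith
    exact hn ▸ h1.trans (hneg i)
  exact this.to_subtype

/-- If `I` contains a homogeneous polynomial with a coefficient outside the prime `p`, then each
component of the top local cohomology is killed by an element outside `p`. -/
theorem exists_notMem_smul_eq_zero (hdeg : ∀ i, 0 < deg i) (n N : ℤ) (p : Ideal R₀) [p.IsPrime]
    {f : MvPolynomial (Fin s) R₀} (hf : f ∈ I) (hN : IsWeightedHomogeneous ℰ f N)
    {m₁ : Fin s →₀ ℕ} (hm₁ : f.coeff m₁ ∉ p) :
    ∃ r ∉ p, ∀ y : LocalCohomologyQuot deg I s n, r • y = 0 := by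
  classical
  let v : (Fin s →₀ ℕ) → Lex (Fin s → ℤ) := fun m => toLex fun i => (m i : ℤ)
  have hv : Function.Injective v := fun a b h => by
    ext i
    exact_mod_cast congrFun (toLex.injective h) i
  obtain ⟨m₀, hm₀, hmin⟩ := Finset.exists_min_image
    (f.support.filter fun m => f.coeff m ∉ p) v
    ⟨m₁, by
      rw [Finset.mem_filter, mem_support_iff]
      exact ⟨fun h => hm₁ (h ▸ p.zero_mem), hm₁⟩⟩
  rw [Finset.mem_filter] at hm₀
  have hlow : ∀ m ∈ f.support, v m < v m₀ → f.coeff m ∈ p := fun m hm hlt => by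
    by_contra hc
    exact (hmin m (Finset.mem_filter.mpr ⟨hm, hc⟩)).not_gt hlt
  have := finite_inverseExponent deg hdeg n
  let _ : Fintype (InverseExponent deg n) := Fintype.ofFinite _
  -- Row `b` holds the coefficients of `u^(b - m₀) f` at the inverse monomials.
  let T : Matrix (InverseExponent deg n) (InverseExponent deg n) R₀ := fun b b' =>
    ∑ m ∈ f.support, if b.1 + (v m - v m₀) = b'.1 then f.coeff m else 0
  let B := coboundaries R₀ (quotComponent deg I) 𝒰 ℰ s n
  let φ : Loc 𝒰 Finset.univ →ₗ[R₀] _ := B.mkQ ∘ₗ (topCochain 𝒰).restrictScalars R₀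
  have hφ : ∀ b : Fin s → ℤ, ∑ i, b i * deg i = n → ∀ i, 0 ≤ b i → φ (laurent 𝒰 b) = 0 := by
    intro b hb i hi
    subst hb
    exact (Submodule.Quotient.mk_eq_zero _).mpr
      (topCochain_laurent_mem_coboundaries deg I b i hi)
  have hT : ∀ b, ∑ b', T b b' • φ (laurent 𝒰 (ofLex b'.1)) = 0 := by
    intro b
    have h := congrArg φ (sum_smul_laurent_eq_zero I hf (ofLex (b.1 - v m₀)))
    rw [map_zero, map_sum] at h
    rw [← h]
    simp only [T, Finset.sum_smul, map_smul]
    rw [Finset.sum_comm]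
    refine Finset.sum_congr rfl fun m hm => ?_
    have hadd : ofLex (b.1 - v m₀) + (fun i => (m i : ℤ)) = ofLex (b.1 + (v m - v m₀)) := by
      funext i
      change b.1 i - (m₀ i : ℤ) + m i = b.1 i + (m i - m₀ i)
      ring
    rw [hadd]
    have hsum : ∑ i, ofLex (b.1 + (v m - v m₀)) i * (deg i : ℤ) = n := by
      have e1 := hN (mem_support_iff.mp hm)
      have e2 := hN (mem_support_iff.mp hm₀.1)
      rw [weight_eq_sum] at e1 e2
      have e3 := b.2.2
      rw [← hadd]
      change ∑ i, (ofLex b.1 i - (m₀ i : ℤ) + m i) * (deg i : ℤ) = n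
      simp only [add_mul, sub_mul, Finset.sum_add_distrib, Finset.sum_sub_distrib]
      rw [e1, e2, e3]
      ring
    -- Each term of the relation either matches exactly one column or has a nonnegative exponent,
    -- and then `φ` kills it.
    by_cases hc : ∀ i, ofLex (b.1 + (v m - v m₀)) i < 0
    · let c : InverseExponent deg n := ⟨b.1 + (v m - v m₀), hc, hsum⟩
      rw [Finset.sum_eq_single c]
      · rw [if_pos rfl]
      · intro b' _ hb'
        rw [if_neg, zero_smul]
        exact fun h => hb' (Subtype.ext h.symm)
      · exact fun h => absurd (Finset.mem_univ _) h
    · push Not at hc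
      obtain ⟨i, hi⟩ := hc
      rw [hφ _ hsum i hi, smul_zero]
      refine Finset.sum_eq_zero fun b' _ => ?_
      rw [if_neg, zero_smul]
      intro h
      rw [h] at hi
      exact (b'.2.1 i).not_ge hi
  refine ⟨T.det, Matrix.det_notMem_of_isPrime T p ?_ ?_, ?_⟩
  · intro b b' hlt
    refine sum_mem fun m hm => ?_
    split_ifs with h
    -- Lexicographic order is translation invariant: `b' < b` forces `m < m₀`.
    · refine hlow m hm ?_
      have h1 : b'.1 < b.1 := hlt
      rw [← h] at h1
      exact sub_neg.mp (add_lt_iff_neg_left.mp h1)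
    · exact p.zero_mem
  · intro b
    have : T b b = f.coeff m₀ := by
      simp only [T]
      rw [Finset.sum_eq_single m₀]
      · simp
      · intro m _ hm
        rw [if_neg]
        intro h
        exact hm (hv (sub_eq_zero.mp (add_eq_left.mp h)))
      · exact fun h => absurd hm₀.1 h
    rw [this]
    exact hm₀.2
  · refine smul_localCohomology_eq_zero R₀ _ _ _ fun x hx => ?_
    have hx := locComponent_le_span_laurent deg I n hx
    have hle : Submodule.span R₀
        {x | ∃ b : Fin s → ℤ, ∑ i, b i * deg i = n ∧ laurent 𝒰 b = x} ≤
          LinearMap.ker (T.det • φ) := by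
      refine Submodule.span_le.mpr ?_
      rintro _ ⟨b, hb, rfl⟩
      change T.det • φ (laurent 𝒰 b) = 0
      by_cases hc : ∀ i, b i < 0
      · exact Matrix.det_smul_eq_zero_of_sum_smul_eq_zero T
          (fun b' => φ (laurent 𝒰 (ofLex b'.1))) hT ⟨toLex b, hc, hb⟩
      · push Not at hc
        obtain ⟨i, hi⟩ := hc
        rw [hφ b hb i hi, smul_zero]
    exact (Submodule.Quotient.mk_eq_zero B).mp (hle hx)

/-! ### Detecting inverse monomials modulo the content -/

/-- The ring map from `R₀[U₁, …, Uₛ]` to the Laurent polynomials over `R₀ / content I`. -/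
def toLaurent : MvPolynomial (Fin s) R₀ →+*
    AddMonoidAlgebra (R₀ ⧸ contentIdeal I) (Fin s → ℤ) :=
  eval₂Hom (AddMonoidAlgebra.singleZeroRingHom.comp (Ideal.Quotient.mk (contentIdeal I)))
    fun i => AddMonoidAlgebra.single (Pi.single i 1) 1

theorem prod_single_pow (K : Type*) [CommRing K] (m : Fin s → ℕ) :
    ∏ i, (AddMonoidAlgebra.single (Pi.single i (1 : ℤ)) (1 : K) :
      AddMonoidAlgebra K (Fin s → ℤ)) ^ m i =
      AddMonoidAlgebra.single (fun i => (m i : ℤ)) 1 := by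
  simp only [AddMonoidAlgebra.single_pow, one_pow]
  have h : ∀ t : Finset (Fin s), ∏ i ∈ t, (AddMonoidAlgebra.single
      (m i • Pi.single i (1 : ℤ)) (1 : K) : AddMonoidAlgebra K (Fin s → ℤ)) =
      AddMonoidAlgebra.single (∑ i ∈ t, m i • Pi.single i (1 : ℤ)) 1 := by
    intro t
    induction t using Finset.induction_on with
    | empty => rfl
    | insert a t ha ih =>
      rw [Finset.prod_insert ha, ih, Finset.sum_insert ha, AddMonoidAlgebra.single_mul_single,
        one_mul]
  rw [h]
  congr 1
  funext j
  simp [Finset.sum_apply, Pi.single_apply]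

theorem toLaurent_eq_sum (f : MvPolynomial (Fin s) R₀) :
    toLaurent I f = ∑ m ∈ f.support,
      AddMonoidAlgebra.single (fun i => (m i : ℤ)) (Ideal.Quotient.mk _ (f.coeff m)) := by
  rw [ringHom_eq_sum]
  refine Finset.sum_congr rfl fun m _ => ?_
  simp only [toLaurent, coe_eval₂Hom, eval₂_C, eval₂_X]
  rw [prod_single_pow]
  change AddMonoidAlgebra.single 0 _ * _ = _
  rw [AddMonoidAlgebra.single_mul_single, zero_add, mul_one]

theorem toLaurent_coeff_eq_zero (f : MvPolynomial (Fin s) R₀) {b : Fin s → ℤ} {i : Fin s}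
    (hb : b i < 0) : (toLaurent I f).coeff b = 0 := by
  rw [toLaurent_eq_sum, AddMonoidAlgebra.coeff_sum, Finsupp.finsetSum_apply]
  refine Finset.sum_eq_zero fun m _ => ?_
  rw [AddMonoidAlgebra.coeff_single, Finsupp.single_apply, if_neg]
  rintro rfl
  exact hb.not_ge (Int.natCast_nonneg _)

theorem toLaurent_eq_zero {f : MvPolynomial (Fin s) R₀} (hf : f ∈ I) : toLaurent I f = 0 := by
  rw [toLaurent_eq_sum]
  refine Finset.sum_eq_zero fun m _ => ?_
  have h : f.coeff m ∈ contentIdeal I := Ideal.subset_span ⟨f, hf, m, rfl⟩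
  rw [Ideal.Quotient.eq_zero_iff_mem.mpr h, AddMonoidAlgebra.single_zero]

/-- The map induced by `toLaurent` on `R₀[U₁, …, Uₛ] / I`. -/
def quotToLaurent : MvPolynomial (Fin s) R₀ ⧸ I →+*
    AddMonoidAlgebra (R₀ ⧸ contentIdeal I) (Fin s → ℤ) :=
  Ideal.Quotient.lift I (toLaurent I) fun _ => toLaurent_eq_zero I

theorem quotToLaurent_prod (m : Fin s → ℕ) :
    quotToLaurent I (∏ i, 𝒰 i ^ m i) = AddMonoidAlgebra.single (fun i => (m i : ℤ)) 1 := by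
  rw [← prod_single_pow, map_prod]
  refine Finset.prod_congr rfl fun i _ => ?_
  rw [map_pow]
  congr 1
  simp [quotToLaurent, toLaurent]

theorem isUnit_single_one (K : Type*) [CommRing K] (b : Fin s → ℤ) :
    IsUnit (AddMonoidAlgebra.single b 1 : AddMonoidAlgebra K (Fin s → ℤ)) := by
  refine IsUnit.of_mul_eq_one (AddMonoidAlgebra.single (-b) 1) ?_
  rw [AddMonoidAlgebra.single_mul_single, add_neg_cancel, one_mul]
  rfl

/-- The map induced by `toLaurent` on the localization of `R₀[U₁, …, Uₛ] / I` at the product of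
the variables. -/
def locToLaurent : Loc 𝒰 Finset.univ →+*
    AddMonoidAlgebra (R₀ ⧸ contentIdeal I) (Fin s → ℤ) :=
  IsLocalization.Away.lift (∏ i ∈ Finset.univ, 𝒰 i) (g := quotToLaurent I) (by
    have := quotToLaurent_prod I (fun _ => 1)
    simp only [pow_one] at this
    rw [this]
    exact isUnit_single_one _ _)

theorem locToLaurent_algebraMap (a : MvPolynomial (Fin s) R₀ ⧸ I) :
    locToLaurent I (algebraMap _ _ a) = quotToLaurent I a :=
  IsLocalization.Away.lift_eq _ _ _

theorem locToLaurent_laurent (b : Fin s → ℤ) :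
    locToLaurent I (laurent 𝒰 b) = AddMonoidAlgebra.single b 1 := by
  have hnat : ∀ m : Fin s → ℕ, locToLaurent I (laurent 𝒰 fun i => (m i : ℤ)) =
      AddMonoidAlgebra.single (fun i => (m i : ℤ)) 1 := fun m => by
    rw [laurent_natCast, locToLaurent_algebraMap, quotToLaurent_prod]
  have hb : (b + fun i => (((-b i).toNat : ℕ) : ℤ)) = fun i => (((b i).toNat : ℕ) : ℤ) := by
    funext i
    simp only [Pi.add_apply]
    omega
  refine (isUnit_single_one _ fun i => (((-b i).toNat : ℕ) : ℤ)).mul_left_injective ?_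
  change locToLaurent I (laurent 𝒰 b) * _ = AddMonoidAlgebra.single b 1 * _
  rw [AddMonoidAlgebra.single_mul_single, ← hnat, ← map_mul, ← laurent_add, hb, hnat, one_mul]

/-- Clearing the denominator of `x` shifts exponents only away from `i`, and a polynomial has no
negative exponent at `i`. -/
theorem locToLaurent_res_coeff_eq_zero (i : Fin s) (x : Loc 𝒰 (Finset.univ.erase i))
    {b : Fin s → ℤ} (hb : b i < 0) :
    (locToLaurent I (res 𝒰 (Finset.erase_subset _ _) x)).coeff b = 0 := by
  obtain ⟨⟨a, ⟨_, k, rfl⟩⟩, hx⟩ :=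
    IsLocalization.surj (Submonoid.powers (∏ j ∈ Finset.univ.erase i, 𝒰 j)) x
  obtain ⟨f, rfl⟩ := Ideal.Quotient.mk_surjective a
  have h := congrArg (fun y => locToLaurent I (res 𝒰 (Finset.erase_subset _ _) y)) hx
  simp only [map_mul, res_algebraMap, locToLaurent_algebraMap] at h
  rw [← locToLaurent_algebraMap, algebraMap_prod_pow, locToLaurent_laurent] at h
  have h1 := congrArg (fun g => AddMonoidAlgebra.coeff g
    (b + fun j => ((if j ∈ Finset.univ.erase i then k else 0 : ℕ) : ℤ))) h
  simp only [AddMonoidAlgebra.coeff_mul_single_apply, mul_one, add_neg_cancel_right] at h1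
  rw [h1]
  exact toLaurent_coeff_eq_zero I f (i := i) (by simpa using hb)

theorem not_subsingleton_localCohomologyQuot (h : contentIdeal I ≠ ⊤) (b : Fin s → ℤ)
    (hb : ∀ i, b i < 0) : ¬ Subsingleton (LocalCohomologyQuot deg I s (∑ i, b i * deg i)) := by
  intro hs
  have h1 := topCochain_mem_coboundaries_of_subsingleton R₀ _ _ _ hs
    (laurent_mem_locComponent deg I b)
  have h2 := topValue_mem_of_mem_coboundaries R₀ _ _ _ h1
    { carrier := {x | (locToLaurent I x).coeff b = 0}
      zero_mem' := by simp
      add_mem' := fun {x y} hx hy => by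
        simp only [Set.mem_ofPred_eq] at hx hy ⊢
        rw [map_add, AddMonoidAlgebra.coeff_add, Finsupp.add_apply, hx, hy, add_zero]
      neg_mem' := fun {x} hx => by
        simp only [Set.mem_ofPred_eq] at hx ⊢
        rw [map_neg, AddMonoidAlgebra.coeff_neg, Finsupp.neg_apply, hx, neg_zero] }
    (fun i x => locToLaurent_res_coeff_eq_zero I i x (hb i))
  rw [topValue_topCochain] at h2
  have h3 : (locToLaurent I (laurent 𝒰 b)).coeff b = 0 := h2
  rw [locToLaurent_laurent, AddMonoidAlgebra.coeff_single, Finsupp.single_eq_same] at h3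
  have := Ideal.Quotient.nontrivial_iff.mpr h
  exact one_ne_zero h3

/-! ### Content of a homogeneous ideal, and the theorem -/

/-- A prime that does not contain the content of the homogeneous ideal `I` does not contain the
annihilator of a component of the top local cohomology. -/
theorem exists_notMem_smul_eq_zero_of_not_contentIdeal_le (hdeg : ∀ i, 0 < deg i)
    (hI : I.IsHomogeneous (weightedHomogeneousSubmodule R₀ deg)) (n : ℤ) (p : Ideal R₀) [p.IsPrime]
    (hp : ¬ contentIdeal I ≤ p) :
    ∃ r ∉ p, ∀ y : LocalCohomologyQuot deg I s n, r • y = 0 := by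
  classical
  rw [contentIdeal, Ideal.span_le, Set.not_subset] at hp
  obtain ⟨_, ⟨f, hf, m, rfl⟩, hm⟩ := hp
  -- The component of `f` in the degree of `m` stays in `I` and keeps the coefficient at `m`.
  have hg := weightedHomogeneousComponent_mem_of_mem R₀ deg hI hf (Finsupp.weight deg m)
  refine exists_notMem_smul_eq_zero deg I hdeg n (Finsupp.weight deg m : ℕ) p hg (m₁ := m) ?_ ?_
  · intro m' hm'
    rw [coeff_weightedHomogeneousComponent] at hm'
    have h : Finsupp.weight deg m' = Finsupp.weight deg m := by
      by_contra hc
      exact hm' (if_neg hc)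
    rw [← h, weight_eq_sum, Finsupp.weight_apply, Finsupp.sum_fintype _ _ (by simp)]
    simp
  · rwa [coeff_weightedHomogeneousComponent, if_pos rfl]

end

end GradedCech

end

theorem theorem1 {R₀ : Type*} [CommRing R₀] [IsDomain R₀] [IsNoetherianRing R₀] {s : ℕ}
    (deg : Fin s → ℕ) (hdeg : ∀ i, 0 < deg i)
    (I : Ideal (MvPolynomial (Fin s) R₀))
    (hI : I.IsHomogeneous (MvPolynomial.weightedHomogeneousSubmodule R₀ deg)) :
    (∀ d ∈ AddSubmonoid.closure (Set.range deg),
      ∀ 𝔭 ∈ associatedPrimes R₀ (LocalCohomologyQuot deg I s (-(d : ℤ))),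
        contentIdeal I ≤ 𝔭) ∧
    (∀ d ∈ inverseDegrees deg,
      Subsingleton (LocalCohomologyQuot deg I s (-(d : ℤ))) ↔ contentIdeal I = ⊤) := by
  refine ⟨fun d _ 𝔭 h𝔭 => ?_, fun d hd => ⟨fun hs => ?_, fun hc => ?_⟩⟩
  · by_contra hp
    obtain ⟨hprime, y, hy⟩ := h𝔭
    obtain ⟨r, hr, hry⟩ := GradedCech.exists_notMem_smul_eq_zero_of_not_contentIdeal_le deg I hdeg
      hI (-(d : ℤ)) 𝔭 hp
    -- `𝔭` is the radical of the annihilator of `y`, which contains `r`.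
    refine hr (hy ▸ Ideal.le_radical (Submodule.mem_colon_singleton.mpr ?_))
    exact (Submodule.mem_bot R₀).mpr (hry y)
  · by_contra hc
    obtain ⟨l, hl, rfl⟩ := hd
    refine GradedCech.not_subsingleton_localCohomologyQuot deg I hc (fun i => -(l i : ℤ))
      (fun i => by have := hl i; omega) ?_
    convert hs using 2
    simp
  · refine subsingleton_of_forall_eq 0 fun y => ?_
    by_contra hy
    -- The annihilator of a nonzero `y` lies in a maximal ideal, yet some element outside that ideal
    -- kills `y`.
    have hne : (LinearMap.toSpanSingleton R₀ _ y).ker ≠ ⊤ := by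
      rw [Ne, Ideal.eq_top_iff_one]
      simpa using hy
    obtain ⟨𝔪, h𝔪, hle⟩ := Ideal.exists_le_maximal _ hne
    obtain ⟨r, hr, hry⟩ := GradedCech.exists_notMem_smul_eq_zero_of_not_contentIdeal_le deg I hdeg
      hI (-(d : ℤ)) 𝔪 (fun h => h𝔪.ne_top (top_le_iff.mp (hc ▸ h)))
    exact hr (hle (hry y))
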